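/- For $A\subseteq\mathbb N$ and $n\ge 1$ let $\rho_n(A)=|A\cap\{0,\dots,n-1\}|/n$. The lower density of $A$ is $\underline\rho(A)=\liminf_n\rho_n(A)$, and $A$ has density $d$ if $\lim_n\rho_n(A)=d$. A set $A\subseteq\mathbb N$ is coarsely computable if there is a computable set $C$ such that $\{n: A(n)=C(n)\}$ has density $1$. For $r\in[0,1]$, $A$ is coarsely computable at density $r$ if there is a computable set $C$ with $\underline\rho(\{n:A(n)=C(n)\})\ge r$. The coarse computability bound of $A$ is $\gamma(A)=\sup\{r\in[0,1]: A\text{ is coarsely computable at density }r\}$. A set $G\subseteq\mathbb N$ is $1$-generic if for every c.e. set $S$ of finite binary strings, either some initial segment of $G$ belongs to $S$, or some initial segment of $G$ has no extension in $S$. Theorem. (1) Let $G$ be a $\Delta^0_2$ $1$-generic set, and suppose that $A\le_T G$ and $\gamma(A)=1$. Then $A$ is coarsely computable. (2) Not every nonzero Turing degree contains a set $A$ such that $\gamma(A)=1$ but $A$ is not coarsely computable. That is, there is a noncomputable set $B$ such that every set $A\equiv_T B$ with $\gamma(A)=1$ is coarsely computable. -/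

import Mathlib

namespace CoarseComp

open Filter Topology

/-- A computable set of natural numbers. -/
def ComputableSet (C : Set ℕ) : Prop := ComputablePred fun n => n ∈ C

open Classical in
/-- The characteristic function of `A`, as an oracle. -/
noncomputable def charFun (A : Set ℕ) : ℕ →. ℕ := fun n => Part.some (if n ∈ A then 1 else 0)

/-- Turing reducibility of sets. -/
def SetTuringLE (A B : Set ℕ) : Prop := TuringReducible (charFun A) (charFun B)

/-- Turing equivalence of sets: `A` and `B` have the same Turing degree. -/
def SetTuringEquiv (A B : Set ℕ) : Prop := SetTuringLE A B ∧ SetTuringLE B A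

/-- `A` is `Σ⁰₂`. -/
def IsSigma02 (A : Set ℕ) : Prop :=
  ∃ R : ℕ × ℕ × ℕ → Prop, ComputablePred R ∧ ∀ n, n ∈ A ↔ ∃ x, ∀ y, R (n, x, y)

/-- `A` is `Π⁰₂`. -/
def IsPi02 (A : Set ℕ) : Prop :=
  ∃ R : ℕ × ℕ × ℕ → Prop, ComputablePred R ∧ ∀ n, n ∈ A ↔ ∀ x, ∃ y, R (n, x, y)

/-- `A` is `Δ⁰₂`. -/
def IsDelta02 (A : Set ℕ) : Prop := IsSigma02 A ∧ IsPi02 A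

open Classical in
/-- The binary string `A(0) A(1) ⋯ A(n-1)`. -/
noncomputable def initSeg (A : Set ℕ) (n : ℕ) : List Bool :=
  (List.range n).map fun i => decide (i ∈ A)

/-- Some initial segment of `A` belongs to `S`. -/
def Meets (A : Set ℕ) (S : Set (List Bool)) : Prop := ∃ n, initSeg A n ∈ S

/-- Some initial segment of `A` has no extension in `S`. -/
def Avoids (A : Set ℕ) (S : Set (List Bool)) : Prop :=
  ∃ n, ∀ τ : List Bool, initSeg A n <+: τ → τ ∉ S

/-- `A` is 1-generic: it meets or avoids every c.e. set of binary strings. -/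
def IsOneGeneric (A : Set ℕ) : Prop :=
  ∀ S : Set (List Bool), REPred (fun σ => σ ∈ S) → Meets A S ∨ Avoids A S

/-- The density of `A` below `n`: `|A ∩ {0, …, n-1}| / n`. -/
noncomputable def densityBelow (A : Set ℕ) (n : ℕ) : ℝ := (A ∩ Set.Iio n).ncard / n

/-- The lower density of `A`. -/
noncomputable def lowerDensity (A : Set ℕ) : ℝ := liminf (densityBelow A) atTop

/-- `A` has asymptotic density `d`. -/
def HasDensity (A : Set ℕ) (d : ℝ) : Prop := Tendsto (densityBelow A) atTop (𝓝 d)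

/-- The set of arguments on which `A` and `B` agree. -/
def agreement (A B : Set ℕ) : Set ℕ := {n | n ∈ A ↔ n ∈ B}

/-- `A` is coarsely computable. -/
def CoarselyComputable (A : Set ℕ) : Prop :=
  ∃ C : Set ℕ, ComputableSet C ∧ HasDensity (agreement A C) 1

/-- `A` is coarsely computable at density `r`. -/
def CoarselyComputableAt (A : Set ℕ) (r : ℝ) : Prop :=
  ∃ C : Set ℕ, ComputableSet C ∧ r ≤ lowerDensity (agreement A C)

/-- The coarse computability bound `γ(A)`. -/
noncomputable def coarseBound (A : Set ℕ) : ℝ :=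
  sSup {r : ℝ | r ∈ Set.Icc (0 : ℝ) 1 ∧ CoarselyComputableAt A r}

end CoarseComp

/-!
Fix a reduction of `A` to `G`. Since `γ(A) = 1`, the set `A` agrees with a computable set up to an
error of asymptotic density `1 / 2k`, and genericity carries this over to every string computed by
an oracle extending a suitable initial segment of `G`: above it, any two computed strings of the
same length differ in a fraction of at most `1 / k` of their places. Such a segment exists for each
`k`, and since `G` is `Δ⁰₂` it can be found in the limit. At each scale `2 ^ j` one can therefore
search for an oracle string that extends the current guesses at the first `j` of these segments
and computes `2 ^ (j + 1)` bits. As the guesses settle, the computed strings are closer and closer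
to `A`, and pasting them on the blocks `[2 ^ j, 2 ^ (j + 1))` gives a computable set that agrees
with `A` on a set of density `1`.

The second part follows by letting `B` be a `Δ⁰₂` 1-generic set, which is not computable. It is
built by finite extensions, each of them found in the limit.
-/

namespace CoarseComp

open Filter

section Computability

variable {α β : Type*} [Primcodable α] [Primcodable β]

attribute [fun_prop] Computable Computable.const Computable.comp Computable.pair Computable.fst
  Computable.snd Computable.succ Computable.encode Computable.list_length Computable.unpair

@[fun_prop]
theorem computable_id' : Computable fun a : α => a := Computable.id

@[fun_prop]
theorem computable_getElem? {l : α → List β} {n : α → ℕ} (hl : Computable l) (hn : Computable n) :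
    Computable fun a => (l a)[n a]? :=
  Computable.list_getElem?.comp hl hn

@[fun_prop]
theorem computable_concat {l : α → List β} {b : α → β} (hl : Computable l) (hb : Computable b) :
    Computable fun a => l a ++ [b a] :=
  Computable.list_concat.comp hl hb

@[fun_prop]
theorem computable_natPair {f g : α → ℕ} (hf : Computable f) (hg : Computable g) :
    Computable fun a => Nat.pair (f a) (g a) :=
  Primrec₂.natPair.to_comp.comp hf hg

@[fun_prop]
theorem computable_add {f g : α → ℕ} (hf : Computable f) (hg : Computable g) :
    Computable fun a => f a + g a :=
  Primrec.nat_add.to_comp.comp hf hg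

@[fun_prop]
theorem computable_mul {f g : α → ℕ} (hf : Computable f) (hg : Computable g) :
    Computable fun a => f a * g a :=
  Primrec.nat_mul.to_comp.comp hf hg

@[fun_prop]
theorem computable_pow {f g : α → ℕ} (hf : Computable f) (hg : Computable g) :
    Computable fun a => f a ^ g a :=
  (Primrec₂.unpaired'.1 Nat.Primrec.pow).to_comp.comp hf hg

theorem computablePred_and {p q : α → Prop} (hp : ComputablePred p) (hq : ComputablePred q) :
    ComputablePred fun a => p a ∧ q a := by
  classical
  exact ((Primrec.and.to_comp.comp hp.decide hq.decide).of_eq fun a => by simp).computablePred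

theorem computablePred_or {p q : α → Prop} (hp : ComputablePred p) (hq : ComputablePred q) :
    ComputablePred fun a => p a ∨ q a := by
  classical
  exact ((Primrec.or.to_comp.comp hp.decide hq.decide).of_eq fun a => by simp).computablePred

theorem computablePred_comp {p : β → Prop} (hp : ComputablePred p) {f : α → β}
    (hf : Computable f) : ComputablePred fun a => p (f a) := by
  classical exact (hp.decide.comp hf).computablePred

theorem computablePred_eq {f g : α → β} (hf : Computable f) (hg : Computable g) :
    ComputablePred fun a => f a = g a :=
  computablePred_comp (PrimrecPred.computablePred Primrec.eq) (hf.pair hg)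

theorem computablePred_le {f g : α → ℕ} (hf : Computable f) (hg : Computable g) :
    ComputablePred fun a => f a ≤ g a :=
  computablePred_comp (PrimrecPred.computablePred Primrec.nat_le) (hf.pair hg)

theorem computablePred_lt {f g : α → ℕ} (hf : Computable f) (hg : Computable g) :
    ComputablePred fun a => f a < g a :=
  computablePred_comp (PrimrecPred.computablePred Primrec.nat_lt) (hf.pair hg)

theorem computablePred_isPrefix {f g : α → List β} (hf : Computable f) (hg : Computable g) :
    ComputablePred fun a => f a <+: g a :=
  (computablePred_eq hf (Primrec.list_take.to_comp.comp (Computable.list_length.comp hf) hg)).of_eq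
    fun _ => List.prefix_iff_eq_take.symm

theorem computable_log {b : ℕ} (hb : 1 < b) : Computable (Nat.log b) := by
  have hex : ∀ n, ∃ j, n < b ^ (j + 1) := fun n => ⟨_, Nat.lt_pow_succ_log_self hb n⟩
  refine (Computable.find (P := fun n j => n < b ^ (j + 1))
    (computablePred_lt (by fun_prop) (by fun_prop)) hex).of_eq fun n => ?_
  rw [Nat.find_eq_iff]
  refine ⟨Nat.lt_pow_succ_log_self hb n, fun m hm h => ?_⟩
  have := Nat.log_lt_of_lt_pow' (by omega) h
  omega

theorem computable_of_succ {f : ℕ → β} {step : ℕ × β → β} (hstep : Computable step)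
    (hf : ∀ n, f (n + 1) = step (n, f n)) : Computable f := by
  refine (Computable.nat_rec (g := fun _ => f 0) (h := fun _ x => step x) Computable.id
    (by fun_prop) (hstep.comp Computable.snd)).of_eq fun n => ?_
  induction n with
  | zero => rfl
  | succ n ih => rw [hf, ← ih]; rfl

/-- A listing of `β` by natural numbers, through which unbounded search in `β` reduces to search
in `ℕ`. Numbers that code no element of `β` are sent to `default`. -/
def enum (β : Type*) [Primcodable β] [Inhabited β] (n : ℕ) : β :=
  (Encodable.decode n).getD default

@[simp]
theorem enum_encode [Inhabited β] (b : β) : enum β (Encodable.encode b) = b := by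
  simp [enum]

@[fun_prop]
theorem computable_enum [Inhabited β] : Computable (enum β) :=
  Computable.option_getD Computable.decode (Computable.const default)

theorem exists_enum_iff [Inhabited β] {p : β → Prop} : (∃ n, p (enum β n)) ↔ ∃ b, p b :=
  ⟨fun ⟨_, h⟩ => ⟨_, h⟩, fun ⟨b, h⟩ => ⟨Encodable.encode b, by rwa [enum_encode]⟩⟩

theorem rePred_exists_code {p : α → Prop} (hp : REPred p) :
    ∃ c : Nat.Partrec.Code, ∀ a, p a ↔ (c.eval (Encodable.encode a)).Dom := by
  obtain ⟨c, hc⟩ := Nat.Partrec.Code.exists_code.1 hp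
  exact ⟨c, fun a => by rw [hc]; simp [Part.assert, Part.some, Part.bind]⟩

/-- The stages are the step bounds in the bounded evaluation of a program for `p`. -/
theorem rePred_exists_stages {p : α → Prop} (hp : REPred p) :
    ∃ B : α × ℕ → Bool, Computable B ∧ (∀ a, Monotone fun t => B (a, t)) ∧
      ∀ a, p a ↔ ∃ t, B (a, t) = true := by
  obtain ⟨c, hc⟩ := rePred_exists_code hp
  refine ⟨fun x => (Nat.Partrec.Code.evaln x.2 c (Encodable.encode x.1)).isSome, ?_, ?_, ?_⟩
  · exact Primrec.option_isSome.to_comp.comp (Nat.Partrec.Code.primrec_evaln.to_comp.comp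
      (g := fun x : α × ℕ => ((x.2, c), Encodable.encode x.1)) (by fun_prop))
  · intro a s t hst
    simp only [Bool.le_iff_imp, Option.isSome_iff_exists]
    exact fun ⟨v, hv⟩ => ⟨v, Nat.Partrec.Code.evaln_mono hst hv⟩
  · intro a
    rw [hc, Part.dom_iff_mem]
    simp only [Nat.Partrec.Code.evaln_complete, Option.isSome_iff_exists, Option.mem_def]
    exact exists_comm

theorem rePred_exists_of_computablePred [Inhabited β] {R : α × β → Prop} (hR : ComputablePred R) :
    REPred fun a => ∃ b, R (a, b) := by
  classical
  have hsearch : Computable₂ fun (a : α) n => decide (R (a, enum β n)) :=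
    (hR.decide.comp (g := fun x : α × ℕ => (x.1, enum β x.2)) (by fun_prop)).to₂
  refine (Partrec.rfind hsearch.partrec₂).dom_re.of_eq fun a => ?_
  rw [← exists_enum_iff]
  simp [Nat.rfind_dom]

theorem rePred_exists [Inhabited β] {R : α × β → Prop} (hR : REPred R) :
    REPred fun a => ∃ b, R (a, b) := by
  obtain ⟨B, hB, -, hRB⟩ := rePred_exists_stages hR
  have h : ComputablePred fun x : α × β × ℕ => B ((x.1, x.2.1), x.2.2) = true :=
    computablePred_eq (by fun_prop) (by fun_prop)
  exact (rePred_exists_of_computablePred h).of_eq fun a => by simp [hRB]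

theorem rePred_exists_computable_selector [Inhabited β] {R : α × β → Prop} (hR : REPred R)
    (htot : ∀ a, ∃ b, R (a, b)) : ∃ f : α → β, Computable f ∧ ∀ a, R (a, f a) := by
  obtain ⟨B, hB, -, hRB⟩ := rePred_exists_stages hR
  let Q : α → β × ℕ → Prop := fun a x => B ((a, x.1), x.2) = true
  have hex : ∀ a, ∃ n, Q a (enum (β × ℕ) n) := fun a => by
    obtain ⟨b, hb⟩ := htot a
    obtain ⟨t, ht⟩ := (hRB _).1 hb
    exact exists_enum_iff.2 ⟨(b, t), ht⟩
  have hfind : Computable fun a => Nat.find (hex a) :=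
    Computable.find (P := fun a n => Q a (enum (β × ℕ) n))
      (computablePred_eq (by fun_prop) (by fun_prop)) hex
  exact ⟨fun a => (enum (β × ℕ) (Nat.find (hex a))).1, by fun_prop,
    fun a => (hRB _).2 ⟨_, Nat.find_spec (hex a)⟩⟩

theorem rePred_comp {p : β → Prop} (hp : REPred p) {f : α → β} (hf : Computable f) :
    REPred fun a => p (f a) :=
  Partrec.comp hp hf

theorem rePred_and {p q : α → Prop} (hp : REPred p) (hq : REPred q) :
    REPred fun a => p a ∧ q a :=
  (Partrec.bind hp (Partrec.comp hq Computable.fst).to₂).dom_re.of_eq fun a => by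
    simp [Part.bind, Part.assert, Part.some]

theorem rePred_forall_lt {p : α × ℕ → Prop} (hp : REPred p) {b : α → ℕ} (hb : Computable b) :
    REPred fun a => ∀ i < b a, p (a, i) := by
  have hrec := Partrec.nat_rec (g := fun _ => Part.some ()) hb (Computable.const ()).partrec
    (rePred_comp hp (f := fun x : α × ℕ × Unit => (x.1, x.2.1)) (by fun_prop)).to₂
  refine hrec.dom_re.of_eq fun a => ?_
  induction b a with
  | zero => simp
  | succ n ih =>
    simp only [Nat.forall_lt_succ_right, ← ih]
    simp [Part.bind, Part.assert]

theorem rePred_mem {f : α →. β} (hf : Partrec f) : REPred fun x : α × β => x.2 ∈ f x.1 := by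
  classical
  have heq : REPred fun x : (α × β) × β => x.2 = x.1.2 :=
    (computablePred_eq (by fun_prop) (by fun_prop)).to_re
  refine ((hf.comp Computable.fst).bind heq.to₂).dom_re.of_eq fun x => ?_
  simp [Part.dom_iff_mem]

end Computability

section LimitComputability

variable {α β γ : Type*} [Primcodable α] [Primcodable β] [Primcodable γ]

/-- `f` is computable in the limit: it is the pointwise limit, in the discrete topology, of a
computable sequence of functions. By the limit lemma this is computability from the halting
problem. -/
def LimitComputable (f : α → β) : Prop :=
  ∃ g : ℕ × α → β, Computable g ∧ ∀ a, ∀ᶠ t in atTop, g (t, a) = f a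

open Classical in
/-- `p` is decidable in the limit, that is, `Δ⁰₂`. -/
def LimitDecidable (p : α → Prop) : Prop := LimitComputable fun a => decide (p a)

theorem limitComputable_of_computable {f : α → β} (hf : Computable f) : LimitComputable f :=
  ⟨fun x => f x.2, by fun_prop, fun _ => .of_forall fun _ => rfl⟩

theorem limitComputable_id : LimitComputable fun a : α => a :=
  limitComputable_of_computable computable_id'

theorem LimitComputable.comp {f : β → γ} {h : α → β} (hf : LimitComputable f)
    (hh : LimitComputable h) : LimitComputable fun a => f (h a) := by
  obtain ⟨f', hf', hff'⟩ := hf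
  obtain ⟨h', hh', hhh'⟩ := hh
  refine ⟨fun x => f' (x.1, h' x), by fun_prop, fun a => ?_⟩
  filter_upwards [hhh' a, hff' (h a)] with t ht ht'
  rw [ht, ht']

theorem LimitComputable.pair {f : α → β} {h : α → γ} (hf : LimitComputable f)
    (hh : LimitComputable h) : LimitComputable fun a => (f a, h a) := by
  obtain ⟨f', hf', hff'⟩ := hf
  obtain ⟨h', hh', hhh'⟩ := hh
  refine ⟨fun x => (f' x, h' x), by fun_prop, fun a => ?_⟩
  filter_upwards [hff' a, hhh' a] with t ht ht'
  rw [ht, ht']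

theorem LimitComputable.of_eq {f g : α → β} (hf : LimitComputable f) (h : ∀ a, f a = g a) :
    LimitComputable g :=
  funext h ▸ hf

theorem LimitDecidable.comp {p : β → Prop} (hp : LimitDecidable p) {f : α → β}
    (hf : LimitComputable f) : LimitDecidable fun a => p (f a) :=
  LimitComputable.comp hp hf

theorem LimitDecidable.not {p : α → Prop} (hp : LimitDecidable p) :
    LimitDecidable fun a => ¬p a := by
  refine ((limitComputable_of_computable Primrec.not.to_comp).comp hp).of_eq fun a => ?_
  simp

theorem LimitDecidable.or {p q : α → Prop} (hp : LimitDecidable p) (hq : LimitDecidable q) :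
    LimitDecidable fun a => p a ∨ q a :=
  ((limitComputable_of_computable Primrec.or.to_comp).comp (LimitComputable.pair hp hq)).of_eq
    fun a => by classical simp

theorem LimitDecidable.and {p q : α → Prop} (hp : LimitDecidable p) (hq : LimitDecidable q) :
    LimitDecidable fun a => p a ∧ q a :=
  ((limitComputable_of_computable Primrec.and.to_comp).comp (LimitComputable.pair hp hq)).of_eq
    fun a => by classical simp

theorem limitDecidable_of_computablePred {p : α → Prop} (hp : ComputablePred p) :
    LimitDecidable p := by
  classical exact limitComputable_of_computable hp.decide

theorem limitDecidable_of_rePred {p : α → Prop} (hp : REPred p) : LimitDecidable p := by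
  obtain ⟨B, hB, hmono, hpB⟩ := rePred_exists_stages hp
  refine ⟨fun x => B (x.2, x.1), by fun_prop, fun a => ?_⟩
  by_cases ha : p a
  · obtain ⟨s, hs⟩ := (hpB a).1 ha
    filter_upwards [eventually_ge_atTop s] with t hst
    simpa [ha] using Bool.le_iff_imp.1 (hmono a hst) hs
  · exact .of_forall fun t => by simpa [ha] using fun h => ha ((hpB a).2 ⟨t, h⟩)

theorem limitComputable_of_succ {f : ℕ → β} {step : ℕ × β → β} (hstep : LimitComputable step)
    (hf : ∀ n, f (n + 1) = step (n, f n)) : LimitComputable f := by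
  obtain ⟨step', hstep', hlim⟩ := hstep
  let g : ℕ × ℕ → β := fun x => Nat.rec (f 0) (fun n b => step' (x.1, n, b)) x.2
  refine ⟨g, ?_, fun n => ?_⟩
  · exact Computable.nat_rec (g := fun _ => f 0)
      (h := fun (x : ℕ × ℕ) (y : ℕ × β) => step' (x.1, y)) Computable.snd (by fun_prop)
      (hstep'.comp (g := fun z : (ℕ × ℕ) × ℕ × β => (z.1.1, z.2)) (by fun_prop)).to₂
  · induction n with
    | zero => exact .of_forall fun _ => rfl
    | succ n ih =>
      filter_upwards [ih, hlim (n, f n)] with t ht ht'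
      rw [hf, ← ht', ← ht]

/-- The approximation at stage `t` searches for a witness below `t` only, which makes it total. -/
theorem LimitDecidable.exists_selector [Inhabited β] {R : α × β → Prop} (hR : LimitDecidable R)
    (htot : ∀ a, ∃ b, R (a, b)) : ∃ f : α → β, LimitComputable f ∧ ∀ a, R (a, f a) := by
  classical
  obtain ⟨g, hg, hlim⟩ := hR
  have hex : ∀ a, ∃ n, R (a, enum β n) := fun a => exists_enum_iff.2 (htot a)
  let Q : ℕ × α → ℕ → Prop := fun x n => n = x.1 ∨ g (x.1, x.2, enum β n) = true
  have hQ : ∀ x, ∃ n, Q x n := fun x => ⟨x.1, .inl rfl⟩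
  have hQc : ComputablePred fun y : (ℕ × α) × ℕ => Q y.1 y.2 := computablePred_or
    (computablePred_eq (by fun_prop) (by fun_prop)) (computablePred_eq (by fun_prop) (by fun_prop))
  refine ⟨fun a => enum β (Nat.find (hex a)),
    ⟨fun x => enum β (Nat.find (hQ x)), computable_enum.comp (Computable.find hQc hQ), ?_⟩,
    fun a => Nat.find_spec (hex a)⟩
  intro a
  have hsettled : ∀ᶠ t in atTop, ∀ n ∈ Set.Iic (Nat.find (hex a)),
      g (t, a, enum β n) = decide (R (a, enum β n)) :=
    (Set.finite_Iic _).eventually_all.2 fun n _ => hlim (a, enum β n)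
  filter_upwards [hsettled, eventually_gt_atTop (Nat.find (hex a))] with t ht hlt
  refine congrArg (enum β) ((Nat.find_eq_iff _).2 ⟨.inr ?_, fun n hn => ?_⟩)
  · simpa [ht _ Set.self_mem_Iic] using Nat.find_spec (hex a)
  · simpa [Q, (hn.trans hlt).ne, ht n hn.le] using Nat.find_min (hex a) hn

theorem IsDelta02.limitDecidable {G : Set ℕ} (hG : IsDelta02 G) : LimitDecidable (· ∈ G) := by
  obtain ⟨⟨R, hR, hRG⟩, S, hS, hSG⟩ := hG
  have hRall : LimitDecidable fun w : ℕ × ℕ => ∀ y, R (w.1, w.2, y) := by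
    simpa using (limitDecidable_of_rePred (rePred_exists_of_computablePred (computablePred_comp
      hR.not (f := fun z : (ℕ × ℕ) × ℕ => (z.1.1, z.1.2, z.2)) (by fun_prop)))).not
  have hSall : LimitDecidable fun w : ℕ × ℕ => ∀ y, ¬S (w.1, w.2, y) := by
    simpa using (limitDecidable_of_rePred (rePred_exists_of_computablePred (computablePred_comp
      hS (f := fun z : (ℕ × ℕ) × ℕ => (z.1.1, z.1.2, z.2)) (by fun_prop)))).not
  obtain ⟨f, hf, hfRS⟩ := (hRall.or hSall).exists_selector fun n => by
    by_cases hn : n ∈ G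
    · obtain ⟨x, hx⟩ := (hRG n).1 hn
      exact ⟨x, .inl hx⟩
    · have := mt (hSG n).2 hn
      push Not at this
      exact this.imp fun x hx => .inr hx
  have hmem : ∀ n, n ∈ G ↔ ∀ y, R (n, f n, y) := fun n =>
    ⟨fun hn => (hfRS n).resolve_right fun h => by
      obtain ⟨y, hy⟩ := (hSG n).1 hn (f n)
      exact h y hy, fun h => (hRG n).2 ⟨_, h⟩⟩
  simpa only [hmem] using hRall.comp (limitComputable_id.pair hf)

theorem isDelta02_of_limitDecidable {G : Set ℕ} (hG : LimitDecidable (· ∈ G)) : IsDelta02 G := by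
  obtain ⟨g, hg, hlim⟩ := hG
  have hc : ComputablePred fun x : ℕ × ℕ × ℕ => g (x.2.1 + x.2.2, x.1) = true :=
    computablePred_eq (by fun_prop) (by fun_prop)
  have hstable : ∀ n, ∃ s, ∀ t ≥ s, g (t, n) = true ↔ n ∈ G := fun n =>
    eventually_atTop.1 ((hlim n).mono fun t ht => by simp [ht])
  refine ⟨⟨_, hc, fun n => ?_⟩, _, hc, fun n => ?_⟩ <;> obtain ⟨s, hs⟩ := hstable n
  · refine ⟨fun hn => ⟨s, fun y => (hs _ (Nat.le_add_right _ _)).2 hn⟩, fun ⟨x, hx⟩ => ?_⟩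
    exact (hs _ (Nat.le_add_left _ _)).1 (hx s)
  · refine ⟨fun hn x => ⟨s, (hs _ (Nat.le_add_left _ _)).2 hn⟩, fun h => ?_⟩
    obtain ⟨y, hy⟩ := h s
    exact (hs _ (Nat.le_add_right _ _)).1 hy

end LimitComputability

section InitSeg

@[simp]
theorem length_initSeg (A : Set ℕ) (n : ℕ) : (initSeg A n).length = n := by
  simp [initSeg]

open Classical in
theorem getElem?_initSeg {A : Set ℕ} {n i : ℕ} (h : i < n) :
    (initSeg A n)[i]? = some (decide (i ∈ A)) := by
  simp [initSeg, h]

theorem take_initSeg (A : Set ℕ) {m n : ℕ} (h : m ≤ n) : (initSeg A n).take m = initSeg A m := by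
  simp [initSeg, ← List.map_take, List.take_range, h]

theorem initSeg_isPrefix (A : Set ℕ) {m n : ℕ} (h : m ≤ n) : initSeg A m <+: initSeg A n := by
  rw [← take_initSeg A h]
  exact List.take_prefix _ _

open Classical in
theorem initSeg_succ (A : Set ℕ) (n : ℕ) : initSeg A (n + 1) = initSeg A n ++ [decide (n ∈ A)] := by
  simp [initSeg, List.range_succ]

open Classical in
theorem eq_initSeg {A : Set ℕ} {σ : List Bool} {n : ℕ} (hn : σ.length = n)
    (h : ∀ i < n, σ[i]? = some (decide (i ∈ A))) : σ = initSeg A n := by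
  refine List.ext_getElem? fun i => ?_
  by_cases hi : i < n
  · rw [h i hi, getElem?_initSeg hi]
  · rw [List.getElem?_eq_none (by omega), List.getElem?_eq_none (by simp; omega)]

theorem ComputableSet.computable_initSeg {C : Set ℕ} (hC : ComputableSet C) :
    Computable (initSeg C) := by
  classical
  have hdec : Computable fun n => decide (n ∈ C) := ComputablePred.decide hC
  exact computable_of_succ (step := fun x => x.2 ++ [decide (x.1 ∈ C)])
    (computable_concat Computable.snd (hdec.comp Computable.fst)) (initSeg_succ C)

theorem LimitDecidable.limitComputable_initSeg {G : Set ℕ} (hG : LimitDecidable (· ∈ G)) :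
    LimitComputable (initSeg G) := by
  classical
  have happend : Computable fun x : List Bool × Bool => x.1 ++ [x.2] := by fun_prop
  exact limitComputable_of_succ ((limitComputable_of_computable happend).comp
    ((limitComputable_of_computable Computable.snd).pair
      (LimitComputable.comp hG (limitComputable_of_computable Computable.fst)))) (initSeg_succ G)

end InitSeg

section UsePrinciple

variable {F H : List Bool → ℕ →. ℕ} {G : Set ℕ} {f h : ℕ →. ℕ}

/-- `F` is a partial recursive functional, given by its values on finite oracles, that sends the
oracle `G` to `f`. Only the initial segments of `G` matter; on other strings `F` need not be
monotone. -/
structure Computes (F : List Bool → ℕ →. ℕ) (G : Set ℕ) (f : ℕ →. ℕ) : Prop where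
  partrec : Partrec₂ F
  sound : ∀ {l n v}, v ∈ F (initSeg G l) n → v ∈ f n
  eventually : ∀ {n v}, v ∈ f n → ∀ᶠ l in atTop, v ∈ F (initSeg G l) n

theorem Computes.of_partrec (hf : Nat.Partrec f) (G : Set ℕ) : Computes (fun _ => f) G f where
  partrec := (Partrec.nat_iff.2 hf).comp Computable.snd
  sound hv := hv
  eventually hv := .of_forall fun _ => hv

theorem Computes.oracle (G : Set ℕ) :
    Computes (fun σ n => ((σ[n]?.map Bool.toNat : Option ℕ) : Part ℕ)) G (charFun G) := by
  have hval : ∀ {l n v}, n < l →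
      (v ∈ ((initSeg G l)[n]?.map Bool.toNat : Part ℕ) ↔ v ∈ charFun G n) := by
    intro l n v hl
    by_cases hG : n ∈ G <;> simp [getElem?_initSeg hl, charFun, hG]
  refine ⟨?_, fun {l n v} hv => ?_, fun {n v} hv => ?_⟩
  · exact Computable.ofOption (Computable.option_map Computable.list_getElem?
      ((Primrec.dom_bool Bool.toNat).to_comp.comp Computable.snd))
  · refine (hval ?_).1 hv
    by_contra hl
    simp [not_lt.1 hl] at hv
  · exact (eventually_gt_atTop n).mono fun l hl => (hval hl).2 hv

theorem Computes.pair (hF : Computes F G f) (hH : Computes H G h) :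
    Computes (fun σ n => Nat.pair <$> F σ n <*> H σ n) G
      (fun n => Nat.pair <$> f n <*> h n) := by
  have hmem : ∀ {p q : Part ℕ} {v}, v ∈ Nat.pair <$> p <*> q ↔
      ∃ a ∈ p, ∃ b ∈ q, Nat.pair a b = v := by
    simp [Seq.seq]
  refine ⟨?_, fun hv => ?_, fun hv => ?_⟩
  · have hpair : Partrec₂ fun σ n => (F σ n).bind fun a => (H σ n).map (Nat.pair a) :=
      hF.partrec.bind (((hH.partrec.comp (Computable.fst.comp Computable.fst)
        (Computable.snd.comp Computable.fst))).map (by fun_prop : Computable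
          fun x : (((List Bool × ℕ) × ℕ) × ℕ) => Nat.pair x.1.2 x.2).to₂)
    exact hpair.of_eq fun x => by simp [Seq.seq]
  · obtain ⟨a, ha, b, hb, rfl⟩ := hmem.1 hv
    exact hmem.2 ⟨a, hF.sound ha, b, hH.sound hb, rfl⟩
  · obtain ⟨a, ha, b, hb, rfl⟩ := hmem.1 hv
    filter_upwards [hF.eventually ha, hH.eventually hb] with l hal hbl
    exact hmem.2 ⟨a, hal, b, hbl, rfl⟩

theorem Computes.comp (hF : Computes F G f) (hH : Computes H G h) :
    Computes (fun σ n => H σ n >>= F σ) G (fun n => h n >>= f) where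
  partrec := hH.partrec.bind (hF.partrec.comp (Computable.fst.comp Computable.fst) Computable.snd)
  sound hv := by
    obtain ⟨a, ha, hv⟩ := Part.mem_bind_iff.1 hv
    exact Part.mem_bind_iff.2 ⟨a, hH.sound ha, hF.sound hv⟩
  eventually hv := by
    obtain ⟨a, ha, hv⟩ := Part.mem_bind_iff.1 hv
    filter_upwards [hH.eventually ha, hF.eventually hv] with l hal hvl
    exact Part.mem_bind_iff.2 ⟨a, hal, hvl⟩

/-- Primitive recursion over partial functions, with parameter `a` and recursion variable `n`. -/
def precFun (f h : ℕ →. ℕ) (a n : ℕ) : Part ℕ :=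
  Nat.rec (f a) (fun y IH => IH.bind fun i => h (Nat.pair a (Nat.pair y i))) n

theorem mem_precFun_succ {a n v : ℕ} :
    v ∈ precFun f h a (n + 1) ↔
      ∃ i ∈ precFun f h a n, v ∈ h (Nat.pair a (Nat.pair n i)) :=
  Part.mem_bind_iff

theorem Computes.prec (hF : Computes F G f) (hH : Computes H G h) :
    Computes (fun σ p => precFun (F σ) (H σ) p.unpair.1 p.unpair.2) G
      (fun p => precFun f h p.unpair.1 p.unpair.2) := by
  refine ⟨?_, fun {l p v} => ?_, fun {p v} => ?_⟩
  · exact Partrec.nat_rec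
      (h := fun (x : List Bool × ℕ) y => H x.1 (Nat.pair x.2.unpair.1 (Nat.pair y.1 y.2)))
      (by fun_prop) (hF.partrec.comp Computable.fst (by fun_prop))
      (hH.partrec.comp (Computable.fst.comp Computable.fst) (by fun_prop))
  · generalize p.unpair.1 = a, p.unpair.2 = n
    induction n generalizing v with
    | zero => exact hF.sound
    | succ n ih =>
      simp only [mem_precFun_succ]
      exact fun ⟨i, hi, hv⟩ => ⟨i, ih hi, hH.sound hv⟩
  · generalize p.unpair.1 = a, p.unpair.2 = n
    induction n generalizing v with
    | zero => exact hF.eventually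
    | succ n ih =>
      simp only [mem_precFun_succ]
      rintro ⟨i, hi, hv⟩
      filter_upwards [ih hi, hH.eventually hv] with l hil hvl
      exact ⟨i, hil, hvl⟩

theorem Computes.rfind (hF : Computes F G f) :
    Computes (fun σ a => Nat.rfind fun n => (fun m => decide (m = 0)) <$> F σ (Nat.pair a n)) G
      (fun a => Nat.rfind fun n => (fun m => decide (m = 0)) <$> f (Nat.pair a n)) := by
  have hmem : ∀ {g : ℕ →. ℕ} {a v : ℕ},
      v ∈ (Nat.rfind fun n => (fun m => decide (m = 0)) <$> g (Nat.pair a n)) ↔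
        0 ∈ g (Nat.pair a v) ∧ ∀ i < v, ∃ m ∈ g (Nat.pair a i), m ≠ 0 := by
    intro g a v
    refine Nat.mem_rfind.trans ?_
    simp
  refine ⟨?_, fun {l a v} => ?_, fun {a v} => ?_⟩
  · exact Partrec.rfind ((hF.partrec.comp (Computable.fst.comp Computable.fst) (by fun_prop)).map
      (Primrec.eq.decide.to_comp.comp Computable.snd (Computable.const 0)))
  · simp only [hmem]
    exact fun ⟨h₀, h⟩ => ⟨hF.sound h₀, fun i hi => (h i hi).imp fun m hm => hm.imp_left hF.sound⟩
  · simp only [hmem]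
    rintro ⟨h₀, h⟩
    have hbelow : ∀ᶠ l in atTop, ∀ i ∈ Set.Iio v,
        ∃ m ∈ F (initSeg G l) (Nat.pair a i), m ≠ 0 :=
      (Set.finite_Iio v).eventually_all.2 fun i hi => by
        obtain ⟨m, hm, hm0⟩ := h i hi
        exact (hF.eventually hm).mono fun l hl => ⟨m, hl, hm0⟩
    filter_upwards [hF.eventually h₀, hbelow] with l h₀l hl
    exact ⟨h₀l, hl⟩

theorem exists_computes (hf : Nat.RecursiveIn {charFun G} f) : ∃ F, Computes F G f := by
  induction hf with
  | zero => exact ⟨_, .of_partrec .zero G⟩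
  | succ => exact ⟨_, .of_partrec .succ G⟩
  | left => exact ⟨_, .of_partrec .left G⟩
  | right => exact ⟨_, .of_partrec .right G⟩
  | oracle g hg => exact (Set.mem_singleton_iff.1 hg) ▸ ⟨_, .oracle G⟩
  | pair _ _ ih₁ ih₂ =>
    obtain ⟨⟨F, hF⟩, H, hH⟩ := And.intro ih₁ ih₂
    exact ⟨_, hF.pair hH⟩
  | comp _ _ ih₁ ih₂ =>
    obtain ⟨⟨F, hF⟩, H, hH⟩ := And.intro ih₁ ih₂
    exact ⟨_, hF.comp hH⟩
  | prec _ _ ih₁ ih₂ =>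
    obtain ⟨⟨F, hF⟩, H, hH⟩ := And.intro ih₁ ih₂
    exact ⟨_, hF.prec hH⟩
  | rfind _ ih =>
    obtain ⟨F, hF⟩ := ih
    exact ⟨_, hF.rfind⟩

/-- The r.e. predicate `P (σ, ρ)`, which says that the oracle string `σ` suffices to compute the
string `ρ`, is a Turing reduction of `A` to `G`. -/
structure IsReduction (P : List Bool × List Bool → Prop) (A G : Set ℕ) : Prop where
  rePred : REPred P
  sound : ∀ {l ρ}, P (initSeg G l, ρ) → ρ = initSeg A ρ.length
  eventually : ∀ n, ∀ᶠ l in atTop, P (initSeg G l, initSeg A n)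

theorem SetTuringLE.exists_isReduction {A : Set ℕ} (hAG : SetTuringLE A G) :
    ∃ P, IsReduction P A G := by
  classical
  obtain ⟨F, hF⟩ := exists_computes (RecursiveIn.iff_nat.1 hAG)
  have hval : ∀ {i b}, Bool.toNat b ∈ charFun A i ↔ b = decide (i ∈ A) := by
    intro i b
    by_cases hi : i ∈ A <;> cases b <;> simp [charFun, hi]
  refine ⟨fun x => ∀ i < x.2.length, ((x.2[i]?).getD false).toNat ∈ F x.1 i, ?_,
    fun {l ρ} hρ => eq_initSeg rfl fun i hi => ?_, fun n => ?_⟩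
  · have hbit : Computable fun y : (List Bool × List Bool) × ℕ =>
        ((y.1.2[y.2]?).getD false).toNat :=
      (Primrec.dom_bool Bool.toNat).to_comp.comp
        (Computable.option_getD (by fun_prop) (Computable.const false))
    exact rePred_forall_lt (rePred_comp (rePred_mem hF.partrec)
      (f := fun y : (List Bool × List Bool) × ℕ =>
        ((y.1.1, y.2), ((y.1.2[y.2]?).getD false).toNat)) (by fun_prop)) (by fun_prop)
  · have hbit := hval.1 (hF.sound (hρ i hi))
    rw [List.getElem?_eq_getElem hi, Option.getD_some] at hbit
    rw [List.getElem?_eq_getElem hi, hbit]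
  · simp only [length_initSeg]
    refine (Set.finite_Iio n).eventually_all.2 fun i hi => hF.eventually (hval.2 ?_)
    rw [getElem?_initSeg hi, Option.getD_some]

end UsePrinciple

section Density

variable {A C : Set ℕ}

open Classical in
/-- The number of arguments below `n` on which `A` and `C` differ. -/
noncomputable def diffCount (A C : Set ℕ) (n : ℕ) : ℕ :=
  ((Finset.range n).filter fun i => ¬(i ∈ A ↔ i ∈ C)).card

open Classical in
theorem diffCount_mono (A C : Set ℕ) : Monotone (diffCount A C) := fun _ _ hmn =>
  Finset.card_le_card (Finset.filter_subset_filter _ (Finset.range_subset_range.2 hmn))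

theorem densityBelow_agreement (A C : Set ℕ) {n : ℕ} (hn : 0 < n) :
    densityBelow (agreement A C) n = 1 - (diffCount A C n : ℝ) / n := by
  classical
  have hset : agreement A C ∩ Set.Iio n = ((Finset.range n).filter fun i => i ∈ A ↔ i ∈ C) := by
    ext i
    simp [agreement, and_comm]
  have hcard : ((Finset.range n).filter fun i => i ∈ A ↔ i ∈ C).card + diffCount A C n = n := by
    simpa [diffCount] using
      Finset.card_filter_add_card_filter_not (s := Finset.range n) (fun i => i ∈ A ↔ i ∈ C)
  have hn' : (n : ℝ) ≠ 0 := by positivity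
  rw [densityBelow, hset, Set.ncard_coe_finset, eq_sub_iff_add_eq, ← add_div, div_eq_one_iff_eq hn']
  exact_mod_cast hcard

theorem densityBelow_nonneg (A : Set ℕ) (n : ℕ) : 0 ≤ densityBelow A n := by
  unfold densityBelow
  positivity

theorem hasDensity_agreement_one (h : ∀ k, ∀ᶠ n in atTop, diffCount A C n * k ≤ n) :
    HasDensity (agreement A C) 1 := by
  rw [HasDensity, Metric.tendsto_nhds]
  intro ε hε
  obtain ⟨k, hk⟩ := exists_nat_one_div_lt hε
  filter_upwards [h (k + 1), eventually_gt_atTop 0] with n hn hn0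
  have hn' : (0 : ℝ) < n := by exact_mod_cast hn0
  rw [densityBelow_agreement A C hn0, Real.dist_eq, sub_sub_cancel_left, abs_neg,
    abs_of_nonneg (by positivity)]
  refine lt_of_le_of_lt ?_ hk
  rw [div_le_div_iff₀ hn' (by positivity), one_mul]
  exact_mod_cast hn

theorem exists_computableSet_diffCount_le (hA : coarseBound A = 1) (k : ℕ) :
    ∃ C, ComputableSet C ∧ ∀ᶠ n in atTop, diffCount A C n * k ≤ n := by
  have hne : {r : ℝ | r ∈ Set.Icc (0 : ℝ) 1 ∧ CoarselyComputableAt A r}.Nonempty := by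
    by_contra h
    rw [Set.not_nonempty_iff_eq_empty] at h
    rw [coarseBound, h, Real.sSup_empty] at hA
    exact zero_ne_one hA
  have hlt : 1 - 1 / ((k : ℝ) + 1) < coarseBound A := by
    rw [hA]
    exact sub_lt_self _ (by positivity)
  obtain ⟨r, ⟨-, C, hC, hr⟩, hkr⟩ := exists_lt_of_lt_csSup hne hlt
  have hdense := eventually_lt_of_lt_liminf (hkr.trans_le hr)
    (isBoundedUnder_of ⟨0, fun n => densityBelow_nonneg _ n⟩)
  refine ⟨C, hC, ?_⟩
  filter_upwards [hdense, eventually_gt_atTop 0] with n hn hn0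
  have hn' : (0 : ℝ) < n := by exact_mod_cast hn0
  rw [densityBelow_agreement A C hn0, sub_lt_sub_iff_left,
    div_lt_div_iff₀ hn' (by positivity), one_mul] at hn
  have hle : diffCount A C n * (k + 1) ≤ n := by exact_mod_cast hn.le
  exact (Nat.mul_le_mul_left _ k.le_succ).trans hle

/-- The number of positions at which two binary strings differ, up to the length of the first. -/
def disagree (ρ μ : List Bool) : ℕ :=
  ((Finset.range ρ.length).filter fun i => ρ[i]? ≠ μ[i]?).card

@[fun_prop]
theorem computable_disagree : Computable fun x : List Bool × List Bool => disagree x.1 x.2 := by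
  have hne : PrimrecRel fun (i : ℕ) (x : List Bool × List Bool) => x.1[i]? ≠ x.2[i]? :=
    (Primrec.eq.comp (Primrec.list_getElem?.comp (Primrec.fst.comp Primrec.snd) Primrec.fst)
      (Primrec.list_getElem?.comp (Primrec.snd.comp Primrec.snd) Primrec.fst)).not
  exact (Primrec.list_length.comp (hne.listFilter.comp
    (Primrec.list_range.comp (Primrec.list_length.comp Primrec.fst)) Primrec.id)).to_comp

theorem disagree_le_add {ρ μ ν : List Bool} (h : ρ.length = ν.length) :
    disagree ρ μ ≤ disagree ρ ν + disagree ν μ := by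
  unfold disagree
  rw [← h]
  refine (Finset.card_le_card fun i => ?_).trans (Finset.card_union_le _ _)
  simp only [Finset.mem_filter, Finset.mem_union]
  grind

theorem disagree_comm {ρ μ : List Bool} (h : ρ.length = μ.length) :
    disagree ρ μ = disagree μ ρ := by
  unfold disagree
  rw [h]
  simp only [ne_comm]

theorem disagree_initSeg (A C : Set ℕ) (n : ℕ) :
    disagree (initSeg A n) (initSeg C n) = diffCount A C n := by
  classical
  unfold disagree diffCount
  rw [length_initSeg]
  congr 1
  refine Finset.filter_congr fun i hi => ?_
  rw [Finset.mem_range] at hi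
  rw [getElem?_initSeg hi, getElem?_initSeg hi]
  simp

end Density

section Blocks

variable {A : Set ℕ} {ρ : ℕ → List Bool}

/-- The set that follows `ρ j` on the block `[2 ^ j, 2 ^ (j + 1))`. Its value at `0` is read from
`ρ 0`, since `Nat.log 2 0 = 0`. -/
def blockSet (ρ : ℕ → List Bool) : Set ℕ := {n | (ρ (Nat.log 2 n))[n]? = some true}

theorem computableSet_blockSet (hρ : Computable ρ) : ComputableSet (blockSet ρ) :=
  computablePred_eq
    (computable_getElem? (hρ.comp (computable_log one_lt_two)) computable_id') (by fun_prop)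

theorem diffCount_blockSet_two_pow_succ (A : Set ℕ) (hlen : ∀ j, (ρ j).length = 2 ^ (j + 1))
    (j : ℕ) : diffCount A (blockSet ρ) (2 ^ (j + 1)) ≤
      diffCount A (blockSet ρ) (2 ^ j) + disagree (ρ j) (initSeg A (2 ^ (j + 1))) := by
  classical
  unfold diffCount disagree
  refine (Finset.card_le_card fun n => ?_).trans (Finset.card_union_le _ _)
  simp only [Finset.mem_filter, Finset.mem_union, Finset.mem_range, hlen]
  rintro ⟨hn, hne⟩
  by_cases hj : n < 2 ^ j
  · exact .inl ⟨hj, hne⟩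
  · refine .inr ⟨hn, fun heq => hne ?_⟩
    have hlog : Nat.log 2 n = j := Nat.log_eq_of_pow_le_of_lt_pow (not_lt.1 hj) hn
    rw [getElem?_initSeg hn] at heq
    simp [blockSet, hlog, heq]

theorem diffCount_blockSet_two_pow_le (hlen : ∀ j, (ρ j).length = 2 ^ (j + 1)) {K j₀ : ℕ}
    (hclose : ∀ j ≥ j₀, disagree (ρ j) (initSeg A (2 ^ (j + 1))) * K ≤ 2 ^ (j + 1))
    {j : ℕ} (hj : j₀ ≤ j) :
    diffCount A (blockSet ρ) (2 ^ j) * K ≤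
      diffCount A (blockSet ρ) (2 ^ j₀) * K + 2 * 2 ^ j := by
  induction j, hj using Nat.le_induction with
  | base => exact Nat.le_add_right _ _
  | succ j hj ih =>
    calc diffCount A (blockSet ρ) (2 ^ (j + 1)) * K
        ≤ diffCount A (blockSet ρ) (2 ^ j) * K
            + disagree (ρ j) (initSeg A (2 ^ (j + 1))) * K := by
          rw [← add_mul]
          exact Nat.mul_le_mul_right K (diffCount_blockSet_two_pow_succ A hlen j)
      _ ≤ (diffCount A (blockSet ρ) (2 ^ j₀) * K + 2 * 2 ^ j) + 2 ^ (j + 1) :=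
          Nat.add_le_add ih (hclose j hj)
      _ = diffCount A (blockSet ρ) (2 ^ j₀) * K + 2 * 2 ^ (j + 1) := by ring

theorem hasDensity_agreement_blockSet (hlen : ∀ j, (ρ j).length = 2 ^ (j + 1))
    (hclose : ∀ k, ∀ᶠ j in atTop, disagree (ρ j) (initSeg A (2 ^ (j + 1))) * k ≤ 2 ^ (j + 1)) :
    HasDensity (agreement A (blockSet ρ)) 1 := by
  refine hasDensity_agreement_one fun k => ?_
  obtain ⟨j₀, hj₀⟩ := eventually_atTop.1 (hclose (5 * k))
  set c := diffCount A (blockSet ρ) (2 ^ j₀) * (5 * k)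
  filter_upwards [eventually_ge_atTop c, eventually_ge_atTop (2 ^ j₀), eventually_ne_atTop 0]
    with n hcn hjn hn
  have hlog : j₀ ≤ Nat.log 2 n + 1 := Nat.le_succ_of_le (Nat.le_log_of_pow_le one_lt_two hjn)
  have hbound : diffCount A (blockSet ρ) n * (5 * k) ≤ 5 * n :=
    calc diffCount A (blockSet ρ) n * (5 * k)
        ≤ diffCount A (blockSet ρ) (2 ^ (Nat.log 2 n + 1)) * (5 * k) :=
          Nat.mul_le_mul_right _ (diffCount_mono _ _ (Nat.lt_pow_succ_log_self one_lt_two n).le)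
      _ ≤ c + 2 * 2 ^ (Nat.log 2 n + 1) := diffCount_blockSet_two_pow_le hlen hj₀ hlog
      _ = c + 4 * 2 ^ Nat.log 2 n := by ring
      _ ≤ n + 4 * n := Nat.add_le_add hcn (Nat.mul_le_mul_left 4 (Nat.pow_log_le_self 2 hn))
      _ = 5 * n := by ring
  rw [mul_left_comm] at hbound
  exact Nat.le_of_mul_le_mul_left hbound (by norm_num)

end Blocks

section Splittings

variable {P : List Bool × List Bool → Prop} {A G : Set ℕ}

/-- Two extensions of `σ` compute, via `P`, strings of a common length `n ≥ |σ|` that differ in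
more than `n / k` places. -/
def HasSplitting (P : List Bool × List Bool → Prop) (k : ℕ) (σ : List Bool) : Prop :=
  ∃ τ ρ τ' ρ', (σ <+: τ ∧ P (τ, ρ)) ∧ (σ <+: τ' ∧ P (τ', ρ')) ∧
    ρ.length = ρ'.length ∧ σ.length ≤ ρ.length ∧ ρ.length < disagree ρ ρ' * k

theorem rePred_hasSplitting (hP : REPred P) :
    REPred fun x : ℕ × List Bool => HasSplitting P x.1 x.2 := by
  have hbranch : REPred fun y : List Bool × List Bool × List Bool => y.1 <+: y.2.1 ∧ P y.2 :=
    rePred_and (computablePred_isPrefix (by fun_prop) (by fun_prop)).to_re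
      (rePred_comp hP (by fun_prop))
  have hsize : ComputablePred fun y : (ℕ × List Bool) × (List Bool × List Bool) =>
      y.2.1.length = y.2.2.length ∧ y.1.2.length ≤ y.2.1.length ∧
        y.2.1.length < disagree y.2.1 y.2.2 * y.1.1 :=
    computablePred_and (computablePred_eq (by fun_prop) (by fun_prop))
      (computablePred_and (computablePred_le (by fun_prop) (by fun_prop))
        (computablePred_lt (by fun_prop) (by fun_prop)))
  have hsplit := rePred_exists (α := ℕ × List Bool)
    (β := (List Bool × List Bool) × List Bool × List Bool)
    (rePred_and (rePred_comp hbranch (f := fun z => (z.1.2, z.2.1)) (by fun_prop))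
      (rePred_and (rePred_comp hbranch (f := fun z => (z.1.2, z.2.2)) (by fun_prop))
        (rePred_comp hsize.to_re (f := fun z => (z.1, z.2.1.2, z.2.2.2)) (by fun_prop))))
  exact hsplit.of_eq fun x => by simp [HasSplitting]

/-- Otherwise the c.e. set of strings computing something far from `C` would be dense along `G`,
so that `G` would meet it, and `A` itself would be far from `C`. -/
theorem IsOneGeneric.exists_forall_disagree_le (hG : IsOneGeneric G) (hP : IsReduction P A G)
    {C : Set ℕ} (hC : ComputableSet C) {k : ℕ} (hAC : ∀ᶠ n in atTop, diffCount A C n * k ≤ n) :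
    ∃ l, ∀ τ ρ, initSeg G l <+: τ → P (τ, ρ) → l ≤ ρ.length →
      disagree ρ (initSeg C ρ.length) * k ≤ ρ.length := by
  obtain ⟨m, hm⟩ := eventually_atTop.1 hAC
  have hinit : Computable fun ρ : List Bool => initSeg C ρ.length :=
    hC.computable_initSeg.comp Computable.list_length
  have hfar : ComputablePred fun ρ : List Bool =>
      m ≤ ρ.length ∧ ρ.length < disagree ρ (initSeg C ρ.length) * k :=
    computablePred_and (computablePred_le (by fun_prop) (by fun_prop))
      (computablePred_lt (by fun_prop) (by fun_prop))
  have hS : REPred fun τ : List Bool => ∃ ρ, P (τ, ρ) ∧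
      m ≤ ρ.length ∧ ρ.length < disagree ρ (initSeg C ρ.length) * k :=
    rePred_exists (rePred_and hP.rePred (rePred_comp hfar.to_re Computable.snd))
  rcases hG {τ | _} hS with ⟨l, ρ, hPρ, hmρ, hlt⟩ | ⟨l, hl⟩
  · rw [hP.sound hPρ, length_initSeg, disagree_initSeg] at hlt
    exact absurd (hm _ hmρ) hlt.not_ge
  · refine ⟨max l m, fun τ ρ hτ hPρ hρ => not_lt.1 fun hlt => ?_⟩
    exact hl τ ((initSeg_isPrefix G (le_max_left l m)).trans hτ)
      ⟨ρ, hPρ, (le_max_right l m).trans hρ, hlt⟩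

theorem IsOneGeneric.exists_not_hasSplitting (hG : IsOneGeneric G) (hP : IsReduction P A G)
    (hA : coarseBound A = 1) (k : ℕ) : ∃ l, ¬HasSplitting P k (initSeg G l) := by
  obtain ⟨C, hC, hAC⟩ := exists_computableSet_diffCount_le hA (2 * k)
  obtain ⟨l, hl⟩ := hG.exists_forall_disagree_le hP hC hAC
  refine ⟨l, ?_⟩
  rintro ⟨τ, ρ, τ', ρ', ⟨hτ, hPρ⟩, ⟨hτ', hPρ'⟩, hlen, hlρ, hlt⟩
  rw [length_initSeg] at hlρ
  set μ := initSeg C ρ.length with hμ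
  have hρ : disagree ρ μ * (2 * k) ≤ ρ.length := hl τ ρ hτ hPρ hlρ
  have hρ' : disagree ρ' μ * (2 * k) ≤ ρ.length := by
    simpa [hμ, hlen] using hl τ' ρ' hτ' hPρ' (hlen ▸ hlρ)
  have htri : disagree ρ ρ' ≤ disagree ρ μ + disagree ρ' μ :=
    (disagree_le_add (by simp [hμ])).trans_eq
      (congrArg _ (disagree_comm (by simp [hμ, hlen])))
  have hk := Nat.mul_le_mul_right k htri
  linarith

/-- The triple `w = (t, τ, ρ)` qualifies to approximate `A` below `2 ^ (j + 1)`: the string `τ`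
computes `ρ` via `P`, and it extends the stage `t` guesses `g (t, k)` at the first `j` strings
without splittings. -/
def IsCandidate (P : List Bool × List Bool → Prop) (g : ℕ × ℕ → List Bool) (j : ℕ)
    (w : ℕ × List Bool × List Bool) : Prop :=
  P w.2 ∧ j ≤ w.1 ∧ w.2.2.length = 2 ^ (j + 1) ∧ ∀ k < j, g (w.1, k) <+: w.2.1

theorem rePred_isCandidate (hP : REPred P) {g : ℕ × ℕ → List Bool} (hg : Computable g) :
    REPred fun x : ℕ × ℕ × List Bool × List Bool => IsCandidate P g x.1 x.2 := by
  refine rePred_and (rePred_comp hP (f := fun x : ℕ × ℕ × List Bool × List Bool => x.2.2)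
    (by fun_prop)) (rePred_and ?_ (rePred_and ?_ ?_))
  · exact (computablePred_le (by fun_prop) (by fun_prop)).to_re
  · exact (computablePred_eq (by fun_prop) (by fun_prop)).to_re
  · exact rePred_forall_lt (p := fun y : (ℕ × ℕ × List Bool × List Bool) × ℕ =>
      g (y.1.2.1, y.2) <+: y.1.2.2.1)
      (computablePred_isPrefix (by fun_prop) (by fun_prop)).to_re (by fun_prop)

theorem IsReduction.exists_isCandidate (hP : IsReduction P A G) {g : ℕ × ℕ → List Bool} {l : ℕ → ℕ}
    (hg : ∀ k, ∀ᶠ t in atTop, g (t, k) = initSeg G (l k)) (j : ℕ) : ∃ w, IsCandidate P g j w := by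
  have hguess : ∀ᶠ t in atTop, ∀ k ∈ Set.Iio j, g (t, k) = initSeg G (l k) :=
    (Set.finite_Iio j).eventually_all.2 fun k _ => hg k
  have hlong : ∀ᶠ m in atTop, ∀ k ∈ Set.Iio j, l k ≤ m :=
    (Set.finite_Iio j).eventually_all.2 fun k _ => eventually_ge_atTop (l k)
  obtain ⟨t, hjt, ht⟩ := ((eventually_ge_atTop j).and hguess).exists
  obtain ⟨m, hPm, hm⟩ := ((hP.eventually (2 ^ (j + 1))).and hlong).exists
  refine ⟨(t, initSeg G m, initSeg A (2 ^ (j + 1))), hPm, hjt, length_initSeg _ _, fun k hk => ?_⟩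
  exact ht k hk ▸ initSeg_isPrefix G (hm k hk)

theorem IsReduction.eventually_disagree_le (hP : IsReduction P A G) {g : ℕ × ℕ → List Bool}
    {k l : ℕ} (hg : ∀ᶠ t in atTop, g (t, k) = initSeg G l)
    (hl : ¬HasSplitting P k (initSeg G l)) :
    ∀ᶠ j in atTop, ∀ w, IsCandidate P g j w →
      disagree w.2.2 (initSeg A (2 ^ (j + 1))) * k ≤ 2 ^ (j + 1) := by
  filter_upwards [eventually_forall_ge_atTop.2 hg, eventually_gt_atTop k, eventually_ge_atTop l]
    with j hgj hkj hlj ⟨t, τ, ρ⟩ ⟨hPρ, hjt, hlen, hτ⟩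
  obtain ⟨m, hPm, hlm⟩ := ((hP.eventually (2 ^ (j + 1))).and (eventually_ge_atTop l)).exists
  have hlρ : (initSeg G l).length ≤ ρ.length := by
    have : j + 1 < 2 ^ (j + 1) := Nat.lt_two_pow_self
    simp only [length_initSeg, hlen]
    omega
  refine not_lt.1 fun hlt => hl ⟨τ, ρ, initSeg G m, initSeg A (2 ^ (j + 1)),
    ⟨hgj t hjt ▸ hτ k hkj, hPρ⟩, ⟨initSeg_isPrefix G hlm, hPm⟩, ?_, hlρ, ?_⟩
  · rw [hlen, length_initSeg]
  · rwa [hlen]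

theorem coarselyComputable_of_turingLE_oneGeneric (hΔ : IsDelta02 G) (hG : IsOneGeneric G)
    (hAG : SetTuringLE A G) (hA : coarseBound A = 1) : CoarselyComputable A := by
  obtain ⟨P, hP⟩ := hAG.exists_isReduction
  have hnosplit : LimitDecidable fun x : ℕ × ℕ => ¬HasSplitting P x.1 (initSeg G x.2) :=
    (limitDecidable_of_rePred (rePred_hasSplitting hP.rePred)).not.comp
      (LimitComputable.pair (limitComputable_of_computable Computable.fst)
        (hΔ.limitDecidable.limitComputable_initSeg.comp
          (limitComputable_of_computable Computable.snd)))
  obtain ⟨l, hl, hlsplit⟩ := hnosplit.exists_selector (hG.exists_not_hasSplitting hP hA)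
  obtain ⟨g, hg, hglim⟩ := hΔ.limitDecidable.limitComputable_initSeg.comp hl
  obtain ⟨w, hw, hcand⟩ := rePred_exists_computable_selector (rePred_isCandidate hP.rePred hg)
    (hP.exists_isCandidate hglim)
  refine ⟨blockSet fun j => (w j).2.2, computableSet_blockSet (by fun_prop),
    hasDensity_agreement_blockSet (fun j => (hcand j).2.2.1) fun k => ?_⟩
  exact (hP.eventually_disagree_le (hglim k) (hlsplit k)).mono fun j hj => hj _ (hcand j)

end Splittings

section OneGeneric

theorem IsOneGeneric.not_computableSet {G : Set ℕ} (hG : IsOneGeneric G) : ¬ComputableSet G := by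
  classical
  intro hC
  have hdiffer : ComputablePred fun σ : List Bool => σ ≠ initSeg G σ.length :=
    (computablePred_eq computable_id' (hC.computable_initSeg.comp Computable.list_length)).not
  rcases hG {σ | σ ≠ initSeg G σ.length} hdiffer.to_re with ⟨n, hn⟩ | ⟨n, hn⟩
  · simp at hn
  · have h := hn (initSeg G n ++ [!decide (n ∈ G)]) (List.prefix_append _ _)
    simp [initSeg_succ] at h

theorem exists_universal_rePred (α : Type*) [Primcodable α] :
    ∃ W : ℕ × α → Prop, REPred W ∧ ∀ p : α → Prop, REPred p → ∃ e, ∀ a, p a ↔ W (e, a) := by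
  refine ⟨fun x => (Nat.Partrec.Code.eval (Denumerable.ofNat Nat.Partrec.Code x.1)
      (Encodable.encode x.2)).Dom,
    (Nat.Partrec.Code.eval_part.comp ((Computable.ofNat _).comp Computable.fst)
      (Computable.encode.comp Computable.snd)).dom_re, fun p hp => ?_⟩
  obtain ⟨c, hc⟩ := rePred_exists_code hp
  exact ⟨Encodable.encode c, fun a => by simp [hc a]⟩

/-- The string `τ` decides `p` in the sense of forcing: it satisfies `p`, or no extension does. -/
def Decides (p : List Bool → Prop) (τ : List Bool) : Prop :=
  p τ ∨ ∀ τ', τ <+: τ' → ¬p τ'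

theorem exists_extension_decides (p : List Bool → Prop) (σ : List Bool) :
    ∃ τ, σ <+: τ ∧ σ.length < τ.length ∧ Decides p τ := by
  by_cases h : ∃ τ, σ ++ [false] <+: τ ∧ p τ
  · obtain ⟨τ, hτ, hp⟩ := h
    exact ⟨τ, (List.prefix_append _ _).trans hτ, by simpa using hτ.length_le, .inl hp⟩
  · exact ⟨σ ++ [false], List.prefix_append _ _, by simp, .inr fun τ hτ hp => h ⟨τ, hτ, hp⟩⟩

theorem limitDecidable_decides {W : ℕ × List Bool → Prop} (hW : REPred W) :
    LimitDecidable fun x : ℕ × List Bool => Decides (fun τ => W (x.1, τ)) x.2 := by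
  have hpre : ComputablePred fun y : (ℕ × List Bool) × List Bool => y.1.2 <+: y.2 :=
    computablePred_isPrefix (by fun_prop) (by fun_prop)
  have hext : REPred fun x : ℕ × List Bool => ∃ τ, x.2 <+: τ ∧ W (x.1, τ) :=
    rePred_exists (rePred_and hpre.to_re
      (rePred_comp hW (f := fun y : (ℕ × List Bool) × List Bool => (y.1.1, y.2)) (by fun_prop)))
  simpa [Decides] using
    (limitDecidable_of_rePred hW).or (limitDecidable_of_rePred hext).not

theorem exists_deciding_chain {W : ℕ × List Bool → Prop} (hW : REPred W) :
    ∃ str : ℕ → List Bool, LimitComputable str ∧ (∀ e, str e <+: str (e + 1)) ∧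
      (∀ e, (str e).length < (str (e + 1)).length) ∧
      ∀ e, Decides (fun τ => W (e, τ)) (str (e + 1)) := by
  have hR : LimitDecidable fun x : (ℕ × List Bool) × List Bool =>
      x.1.2 <+: x.2 ∧ x.1.2.length < x.2.length ∧ Decides (fun τ => W (x.1.1, τ)) x.2 :=
    (limitDecidable_of_computablePred (computablePred_isPrefix (by fun_prop) (by fun_prop))).and
      ((limitDecidable_of_computablePred (computablePred_lt (by fun_prop) (by fun_prop))).and
        ((limitDecidable_decides hW).comp (limitComputable_of_computable
          (by fun_prop : Computable fun x : (ℕ × List Bool) × List Bool => (x.1.1, x.2)))))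
  obtain ⟨next, hnext, hnextR⟩ := hR.exists_selector fun x => exists_extension_decides _ x.2
  let str : ℕ → List Bool := fun e => Nat.rec [] (fun e σ => next (e, σ)) e
  exact ⟨str, limitComputable_of_succ hnext fun _ => rfl, fun e => (hnextR (e, str e)).1,
    fun e => (hnextR (e, str e)).2.1, fun e => (hnextR (e, str e)).2.2⟩

/-- The set whose characteristic sequence is the union of the strings `str e`, provided that they
form a chain for `<+:` and strictly increase in length, so that `str (n + 1)` has an `n`-th bit. -/
def chainSet (str : ℕ → List Bool) : Set ℕ := {n | (str (n + 1))[n]? = some true}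

theorem initSeg_chainSet {str : ℕ → List Bool} (hpre : ∀ e, str e <+: str (e + 1))
    (hlen : ∀ e, (str e).length < (str (e + 1)).length) (e : ℕ) :
    initSeg (chainSet str) (str e).length = str e := by
  have hchain : ∀ {d e}, d ≤ e → str d <+: str e := fun h =>
    Nat.le_induction List.prefix_rfl (fun e _ ih => ih.trans (hpre e)) _ h
  refine (eq_initSeg rfl fun i hi => ?_).symm
  have hi' : i < (str (i + 1)).length := (strictMono_nat_of_lt_succ hlen).le_apply
  have hbit : (str e)[i]? = (str (i + 1))[i]? := by
    rcases le_total e (i + 1) with h | h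
    · rw [List.getElem?_eq_getElem hi, List.getElem?_eq_getElem hi', (hchain h).getElem]
    · rw [List.getElem?_eq_getElem hi, List.getElem?_eq_getElem hi', (hchain h).getElem]
  rw [hbit, List.getElem?_eq_getElem hi']
  simp [chainSet, hi']

theorem limitDecidable_chainSet {str : ℕ → List Bool} (hstr : LimitComputable str) :
    LimitDecidable (· ∈ chainSet str) := by
  have hbit : ComputablePred fun x : List Bool × ℕ => x.1[x.2]? = some true :=
    computablePred_eq (by fun_prop) (by fun_prop)
  exact (limitDecidable_of_computablePred hbit).comp (LimitComputable.pair
    (hstr.comp (limitComputable_of_computable Computable.succ)) limitComputable_id)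

theorem exists_delta02_oneGeneric : ∃ G : Set ℕ, IsDelta02 G ∧ IsOneGeneric G := by
  obtain ⟨W, hW, huniversal⟩ := exists_universal_rePred (List Bool)
  obtain ⟨str, hstr, hpre, hlen, hdec⟩ := exists_deciding_chain hW
  refine ⟨chainSet str, isDelta02_of_limitDecidable (limitDecidable_chainSet hstr), fun S hS => ?_⟩
  obtain ⟨e, he⟩ := huniversal _ hS
  have hseg := initSeg_chainSet hpre hlen (e + 1)
  rcases hdec e with hmeet | havoid
  · exact .inl ⟨_, hseg ▸ (he _).2 hmeet⟩
  · exact .inr ⟨_, fun τ hτ hτS => havoid τ (hseg ▸ hτ) ((he τ).1 hτS)⟩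

end OneGeneric

end CoarseComp

theorem theorem5p11 :
    (∀ G A : Set ℕ, CoarseComp.IsDelta02 G → CoarseComp.IsOneGeneric G →
      CoarseComp.SetTuringLE A G → CoarseComp.coarseBound A = 1 →
        CoarseComp.CoarselyComputable A) ∧
    ¬ ∀ B : Set ℕ, ¬ CoarseComp.ComputableSet B →
      ∃ A : Set ℕ, CoarseComp.SetTuringEquiv A B ∧ CoarseComp.coarseBound A = 1 ∧
        ¬ CoarseComp.CoarselyComputable A := by
  refine ⟨fun G A hΔ hG hAG hA =>
    CoarseComp.coarselyComputable_of_turingLE_oneGeneric hΔ hG hAG hA, fun H => ?_⟩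
  obtain ⟨G, hΔ, hG⟩ := CoarseComp.exists_delta02_oneGeneric
  obtain ⟨A, hAG, hA, hnot⟩ := H G hG.not_computableSet
  exact hnot (CoarseComp.coarselyComputable_of_turingLE_oneGeneric hΔ hG hAG.1 hA)
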